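/- For positive integers $\ell,m,q$ with $q^m\equiv 1 \pmod \ell$, let $$\mathbb{Z}_\ell\rtimes_q\mathbb{Z}_m := \langle\, x,y \mid x^\ell = y^m = yxy^{-1}x^{-q} = 1\,\rangle ,$$ and let $\mathbb{Z}_\ell=\langle x\rangle$ be the subgroup generated by $x$. The derived series of a group $G$ is $G^{(0)}=G$, $G^{(i+1)}=[G^{(i)},G^{(i)}]$, and the derived length of $G$ is the least $k$ with $G^{(k)}=1$. For a subset $S$ of a group $G$, the left (right) Cayley graph of $(G,S)$ is the simple graph with vertex set $G$ in which distinct $u,v$ are adjacent if and only if $v=su$ or $u=sv$ (respectively $v=us$ or $u=vs$) for some $s\in S$. For a finite graph $\mathcal G=(V,E)$ let $$h(\mathcal G)=\min_{\emptyset\neq A\subset V,\ |A|\le |V|/2}\frac{|\partial A|}{|A|},\qquad \partial A=\{\{u,v\}\in E: u\in A,\ v\notin A\}.$$ A sequence of finite graphs $(\mathcal G_i)_{i\in\mathbb N}$ with $|V(\mathcal G_i)|\to\infty$ is expanding if $h(\mathcal G_i)=\Omega(1)$, i.e. if there is a constant $c>0$ with $h(\mathcal G_i)\ge c$ for all sufficiently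 large $i$. 1. For all positive integers $\ell,m,q$ with $q^m\equiv1\pmod\ell$, the commutator subgroup of $\mathbb{Z}_\ell\rtimes_q\mathbb{Z}_m$ is contained in $\mathbb{Z}_\ell$, and the derived length of $\mathbb{Z}_\ell\rtimes_q\mathbb{Z}_m$ is at most $2$; it is equal to $2$ if and only if $q\not\equiv 1\pmod \ell$ (that is, outside the case of the direct product $\mathbb{Z}_\ell\times\mathbb{Z}_m$). 2. Consequently, ZSZ Cayley graphs are not expanders: let $\ell_i,m_i,q_i$ ($i\in\mathbb N$) be positive integers with $q_i^{m_i}\equiv1\pmod{\ell_i}$, put $G_i=\mathbb{Z}_{\ell_i}\rtimes_{q_i}\mathbb{Z}_{m_i}$, suppose that $|G_i|\to\infty$, and let $S_i\subset G_i$ be finite subsets (for example generating sets) with $|S_i|\le K$ for a constant $K$ and all $i$. Then neither the left Cayley graphs of $(G_i,S_i)$ nor the right Cayley graphs of $(G_i,S_i)$ form an expanding family. -/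

import Mathlib

open Filter

/-- The defining relators `x ^ ℓ`, `y ^ m` and `y x y⁻¹ x ^ (-q)`, where `x` and `y` are the free
generators with index `0` and `1`. -/
def zszRels (ℓ m q : ℕ) : Set (FreeGroup (Fin 2)) :=
  {FreeGroup.of 0 ^ ℓ, FreeGroup.of 1 ^ m,
    FreeGroup.of 1 * FreeGroup.of 0 * (FreeGroup.of 1)⁻¹ * (FreeGroup.of 0 ^ q)⁻¹}

/-- The ZSZ group `ℤ_ℓ ⋊_q ℤ_m = ⟨x, y | x ^ ℓ = y ^ m = y x y⁻¹ x ^ (-q) = 1⟩`. -/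
abbrev ZSZ (ℓ m q : ℕ) : Type := PresentedGroup (zszRels ℓ m q)

/-- The generator `x` of the ZSZ group. The normal factor `ℤ_ℓ` is the subgroup it generates. -/
def ZSZ.x (ℓ m q : ℕ) : ZSZ ℓ m q := PresentedGroup.of 0

/-- The derived length: the least `k` such that the `k`-th term of the derived series is trivial
(and `⊤` if there is no such `k`). -/
noncomputable def derivedLength (G : Type*) [Group G] : ℕ∞ :=
  sInf ((fun k : ℕ => (k : ℕ∞)) '' {k : ℕ | derivedSeries G k = ⊥})

/-- The left Cayley graph, as a simple graph: distinct `u` and `v` are adjacent if and only if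
`v = s * u` or `u = s * v` for some `s ∈ S`. -/
def leftCayley {G : Type*} [Group G] (S : Set G) : SimpleGraph G :=
  SimpleGraph.fromRel (fun u v => ∃ s ∈ S, v = s * u)

/-- The right Cayley graph, as a simple graph: distinct `u` and `v` are adjacent if and only if
`v = u * s` or `u = v * s` for some `s ∈ S`. -/
def rightCayley {G : Type*} [Group G] (S : Set G) : SimpleGraph G :=
  SimpleGraph.fromRel (fun u v => ∃ s ∈ S, v = u * s)

/-- The edge boundary `∂A`: the edges with one end in `A` and the other outside `A`. -/
def edgeBoundary {V : Type*} (Γ : SimpleGraph V) (A : Set V) : Set (Sym2 V) :=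
  {e ∈ Γ.edgeSet | ∃ u ∈ A, ∃ v ∉ A, e = s(u, v)}

/-- The edge expansion (Cheeger constant) of a finite graph: the minimum of `|∂A| / |A|` over the
nonempty vertex sets `A` with `|A| ≤ |V| / 2`. -/
noncomputable def cheeger {V : Type*} (Γ : SimpleGraph V) : ℝ :=
  sInf {r : ℝ | ∃ A : Set V, A.Nonempty ∧ (A.ncard : ℝ) ≤ (Nat.card V : ℝ) / 2 ∧
    r = ((edgeBoundary Γ A).ncard : ℝ) / (A.ncard : ℝ)}

/-- A family of finite graphs (of growing sizes) is expanding if its Cheeger constants are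
`Ω(1)`, that is, at least a fixed positive constant for all large indices. -/
def IsExpanding {V : ℕ → Type*} (Γ : ∀ i, SimpleGraph (V i)) : Prop :=
  ∃ c : ℝ, 0 < c ∧ ∀ᶠ i in atTop, c ≤ cheeger (Γ i)

/-! The relation `y x y⁻¹ = x ^ q` makes `H = ⟨x⟩` normal with cyclic quotient, so `commutator G ≤
H` with `H` abelian. This bounds the derived length by 2. Length 2 for `q ≢ 1` needs the
presentation not to collapse, which the affine maps of `ℤ/ℓ` witness. Non-expansion uses only that
`H` and `G ⧸ H` are abelian. Polynomial growth gives an abelian group almost invariant sets whose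
size is bounded in terms of the number of translations and `ε` alone. If `G ⧸ H` is large, such a
set is pulled back from the quotient. Otherwise `H` is large, and its boundedly many Schreier
elements take the place of the generators (`exists_almostInvariant_mul_right`). An almost invariant
set has small edge boundary (`cheeger_le_of_almostInvariant`). -/

/-- A nonempty finite set `A` is `ε`-invariant under the maps in `T` if each of them moves at most
`ε * |A|` points of `A` out of `A`. -/
def IsAlmostInvariant {V : Type*} (T : Set (V → V)) (ε : ℝ) (A : Set V) : Prop :=
  ∀ f ∈ T, (({u ∈ A | f u ∉ A} : Set V).ncard : ℝ) ≤ ε * (A.ncard : ℝ)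

/-- The products of powers `t ^ a t` of the elements `t ∈ T` with exponents `a t < n`. -/
noncomputable def powerBox {B : Type*} [CommGroup B] (T : Finset B) (n : ℕ) : Set B :=
  (fun a : T → Fin n => ∏ t : T, (t : B) ^ (a t : ℕ)) '' Set.univ

/-! ### Almost invariant sets in abelian groups -/

section powerBox

variable {B : Type*} [CommGroup B] (T : Finset B)

lemma powerBox_finite (n : ℕ) : (powerBox T n).Finite := Set.finite_univ.image _

lemma ncard_powerBox_le (n : ℕ) : (powerBox T n).ncard ≤ n ^ T.card := by
  refine (Set.ncard_image_le Set.finite_univ).trans ?_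
  simp [Set.ncard_univ, Nat.card_fun]

lemma powerBox_mono (n : ℕ) : powerBox T n ⊆ powerBox T (n + 1) := by
  rintro _ ⟨a, -, rfl⟩
  exact ⟨fun t => (a t).castSucc, trivial, by simp⟩

lemma one_mem_powerBox (n : ℕ) : 1 ∈ powerBox T (n + 1) :=
  ⟨fun _ => 0, trivial, by simp⟩

lemma mul_mem_powerBox {n : ℕ} {b t : B} (hb : b ∈ powerBox T n) (ht : t ∈ T) :
    b * t ∈ powerBox T (n + 1) := by
  classical
  obtain ⟨a, -, rfl⟩ := hb
  refine ⟨fun s => if (s : B) = t then (a s).succ else (a s).castSucc, trivial, ?_⟩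
  have h : ∀ s : T, (s : B) ^ ((if (s : B) = t then (a s).succ else (a s).castSucc : Fin (n + 1)) : ℕ)
      = (s : B) ^ (a s : ℕ) * (if s = ⟨t, ht⟩ then t else 1) := by
    intro s
    by_cases hs : (s : B) = t
    · have : s = ⟨t, ht⟩ := Subtype.ext hs
      subst this
      simp [pow_succ]
    · have : s ≠ ⟨t, ht⟩ := fun h => hs (congrArg Subtype.val h)
      simp [hs, this]
  simp only [h, Finset.prod_mul_distrib]
  simp

/-- Polynomial growth produces almost invariant sets of bounded size in commutative groups. -/
lemma exists_almostInvariant_of_commGroup (K : ℕ) {ε : ℝ} (hε : 0 < ε) :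
    ∃ N : ℕ, 0 < N ∧ ∀ {B : Type*} [CommGroup B] (T : Finset B), T.card ≤ K →
      ∃ F : Set B, F.Nonempty ∧ F.ncard ≤ N ∧
        IsAlmostInvariant ((fun t b => b * t) '' (T : Set B)) ε F := by
  obtain ⟨R, hR⟩ : ∃ R : ℕ, ((R + 1 : ℕ) : ℝ) ^ K < (1 + ε) ^ R := by
    have h := tendsto_pow_const_div_const_pow_of_one_lt K (show 1 < 1 + ε by linarith)
    -- The shift to `R + 1` and the target `(1 + ε)⁻¹` turn the limit into `(R + 1) ^ K < (1 + ε) ^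
    -- R`.
    have h' := (tendsto_add_atTop_iff_nat 1).2 h
    obtain ⟨R, hR⟩ := (h'.eventually (gt_mem_nhds (show 0 < (1 + ε)⁻¹ by positivity))).exists
    refine ⟨R, ?_⟩
    rw [div_lt_iff₀ (by positivity), pow_succ] at hR
    have : (1 + ε) ≠ 0 := by positivity
    field_simp at hR
    exact_mod_cast hR
  refine ⟨(R + 1) ^ K, by positivity, ?_⟩
  intro B _ T hT
  have hsize : ∀ n ≤ R, (powerBox T (n + 1)).ncard ≤ (R + 1) ^ K := fun n hn =>
    (ncard_powerBox_le T _).trans <|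
      (Nat.pow_le_pow_left (by omega) _).trans (Nat.pow_le_pow_right (by omega) hT)
  -- If all `R` steps grew by a factor above `1 + ε`, the last box would have at least `(1 + ε) ^ R`
  -- elements, more than its bound `(R + 1) ^ K`.
  obtain ⟨n, hn, hgrow⟩ : ∃ n < R, ((powerBox T (n + 2)).ncard : ℝ) ≤
      (1 + ε) * (powerBox T (n + 1)).ncard := by
    by_contra! hcon
    have key : ∀ n ≤ R, (1 + ε) ^ n ≤ ((powerBox T (n + 1)).ncard : ℝ) := by
      intro n
      induction n with
      | zero =>
        intro _
        have := (Set.ncard_pos (powerBox_finite T 1)).2 ⟨1, one_mem_powerBox T 0⟩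
        rw [pow_zero]
        exact_mod_cast this
      | succ n ih =>
        intro hn
        have h1 := ih (by omega)
        have h2 := hcon n (by omega)
        calc (1 + ε) ^ (n + 1) = (1 + ε) * (1 + ε) ^ n := by ring
          _ ≤ (1 + ε) * (powerBox T (n + 1)).ncard := by gcongr
          _ ≤ _ := h2.le
    have h1 := key R le_rfl
    have h2 : ((powerBox T (R + 1)).ncard : ℝ) ≤ ((R + 1 : ℕ) : ℝ) ^ K := by
      exact_mod_cast hsize R le_rfl
    linarith
  refine ⟨powerBox T (n + 1), ⟨1, one_mem_powerBox T n⟩,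
    hsize n hn.le, ?_⟩
  rintro _ ⟨t, ht, rfl⟩
  -- Translation by `t` injects the escaping points into the next shell, which has at most `ε * |F|`
  -- elements.
  have hinj : ({u ∈ powerBox T (n + 1) | u * t ∉ powerBox T (n + 1)}).ncard ≤
      (powerBox T (n + 2) \ powerBox T (n + 1)).ncard :=
    Set.ncard_le_ncard_of_injOn (fun u => u * t) (fun u hu => ⟨mul_mem_powerBox T hu.1 ht, hu.2⟩)
      (fun u _ v _ h => mul_right_cancel h) ((powerBox_finite T _).sdiff)
  have hdiff := Set.ncard_sdiff_add_ncard_of_subset (powerBox_mono T (n + 1)) (powerBox_finite T _)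
  have hd : ((powerBox T (n + 2) \ powerBox T (n + 1)).ncard : ℝ) +
    (powerBox T (n + 1)).ncard = (powerBox T (n + 2)).ncard := by exact_mod_cast hdiff
  have hi : (({u ∈ powerBox T (n + 1) | u * t ∉ powerBox T (n + 1)}).ncard : ℝ) ≤
      (powerBox T (n + 2) \ powerBox T (n + 1)).ncard := by exact_mod_cast hinj
  show (({u ∈ powerBox T (n + 1) | u * t ∉ powerBox T (n + 1)}).ncard : ℝ) ≤ _
  linarith

end powerBox

/-! ### Lifting almost invariant sets to group extensions -/

lemma ncard_setOf_snd_mem {V Q H : Type*} [Finite H] [Fintype Q] (e : V ≃ Q × H)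
    (R : Q → Set H) : ({v | (e v).2 ∈ R (e v).1} : Set V).ncard = ∑ q, (R q).ncard := by
  simp only [← Nat.card_coe_set_eq]
  rw [← Nat.card_sigma]
  refine Nat.card_congr ?_
  exact (Equiv.subtypeEquiv e (q := fun p : Q × H => p.2 ∈ R p.1) fun _ => Iff.rfl).trans
    (Equiv.subtypeProdEquivSigmaSubtype fun q h => h ∈ R q)

/-- Almost invariant sets lift along a product decomposition in which the second coordinate moves
by the given maps, the choice of the map depending on the first coordinate. -/
lemma IsAlmostInvariant.of_equiv_prod {V Q H : Type*} [Finite H] [Finite Q] (e : V ≃ Q × H)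
    {T : Set (V → V)} {T' : Set (H → H)} {ε : ℝ} {F : Set H} (hF : IsAlmostInvariant T' ε F)
    (hT : ∀ f ∈ T, ∀ q, ∃ f' ∈ T', ∀ v, (e v).1 = q → (e (f v)).2 = f' (e v).2) :
    IsAlmostInvariant T ε {v | (e v).2 ∈ F} := by
  have := Fintype.ofFinite Q
  intro f hf
  choose f' hf' hff' using hT f hf
  -- Membership ignores the first coordinate, so escapes can be counted fibre by fibre, wherever `f`
  -- sends the fibre.
  have hset : {u ∈ {v | (e v).2 ∈ F} | f u ∉ {v | (e v).2 ∈ F}} =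
      {u | (e u).2 ∈ (fun q => {h ∈ F | f' q h ∉ F}) (e u).1} := by
    ext u
    simp [hff' (e u).1 u rfl]
  rw [hset, ncard_setOf_snd_mem e (fun q => {h ∈ F | f' q h ∉ F}), ncard_setOf_snd_mem e (fun _ => F)]
  push_cast
  rw [Finset.mul_sum]
  exact Finset.sum_le_sum fun q _ => hF _ (hf' q)

/-- A group as the product of the quotient by a normal subgroup and this subgroup. -/
noncomputable def Subgroup.equivQuotientProd {G : Type*} [Group G] (H : Subgroup G) [H.Normal] :
    G ≃ (G ⧸ H) × H where
  toFun g := (g, ⟨g * (g : G ⧸ H).out⁻¹, by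
    rw [← QuotientGroup.eq_one_iff]; simp⟩)
  invFun p := p.2 * p.1.out
  left_inv g := by simp
  right_inv p := by
    have h : (((p.2 : G) * p.1.out : G) : G ⧸ H) = p.1 := by
      rw [QuotientGroup.mk_mul, (QuotientGroup.eq_one_iff _).2 p.2.2, one_mul,
        QuotientGroup.out_eq']
    ext
    · exact h
    · simp [h]

/-- Large finite groups with an abelian normal subgroup and abelian quotient have almost invariant
sets for the right translations by boundedly many elements. -/
lemma exists_almostInvariant_mul_right (K : ℕ) {ε : ℝ} (hε : 0 < ε) :
    ∃ N : ℕ, 0 < N ∧ ∀ {G : Type*} [Group G] (H : Subgroup G) [IsMulCommutative H] (S : Finset G),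
      commutator G ≤ H → N ≤ Nat.card G → S.card ≤ K → Finite G →
      ∃ A : Set G, A.Nonempty ∧ 2 * A.ncard ≤ Nat.card G ∧
        IsAlmostInvariant ((fun s g => g * s) '' (S : Set G)) ε A := by
  classical
  obtain ⟨N₁, hN₁, h₁⟩ := exists_almostInvariant_of_commGroup K hε
  obtain ⟨N₂, hN₂, h₂⟩ := exists_almostInvariant_of_commGroup (2 * N₁ * K) hε
  -- Either the quotient has order at least `2 * N₁`, or `H` has order at least `2 * N₂`; the
  -- factors 2 make the lifted set at most half of `G`.
  refine ⟨2 * N₁ * (2 * N₂), by positivity, ?_⟩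
  intro G _ H _ S hH hG hS _
  have hn : H.Normal := Subgroup.Normal.of_commutator_le G hH
  let e := H.equivQuotientProd
  have he1 : ∀ g, (e g).1 = (g : G ⧸ H) := fun _ => rfl
  have he2 : ∀ g, ((e g).2 : G) = g * (g : G ⧸ H).out⁻¹ := fun _ => rfl
  have := Fintype.ofFinite (G ⧸ H)
  have := Fintype.ofFinite H
  let _ : CommGroup H :=
    { (inferInstance : Group H) with mul_comm := IsMulCommutative.is_comm.comm }
  have hcard : Nat.card G = Nat.card (G ⧸ H) * Nat.card H := by
    rw [Nat.card_congr e, Nat.card_prod]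
  by_cases hQ : 2 * N₁ ≤ Nat.card (G ⧸ H)
  · let _ : CommGroup (G ⧸ H) :=
      { (inferInstance : Group (G ⧸ H)) with
        mul_comm := (Subgroup.Normal.quotient_commutative_iff_commutator_le.2 hH).is_comm.comm }
    obtain ⟨F, hFne, hFN, hF⟩ := h₁ (S.image (fun s : G => (s : G ⧸ H)))
      (Finset.card_image_le.trans hS)
    let e' := e.trans (Equiv.prodComm _ _)
    refine ⟨{g | (e' g).2 ∈ F}, ?_, ?_, hF.of_equiv_prod e' ?_⟩
    · obtain ⟨x, hx⟩ := hFne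
      exact ⟨e'.symm (1, x), by simpa using hx⟩
    · rw [ncard_setOf_snd_mem e' (fun _ => F), hcard]
      simp only [Finset.sum_const, Finset.card_univ, smul_eq_mul, ← Nat.card_eq_fintype_card]
      nlinarith [Nat.zero_le (Nat.card H)]
    · rintro _ ⟨s, hs, rfl⟩ -
      refine ⟨_, ⟨(s : G ⧸ H), by simpa using ⟨s, hs, rfl⟩, rfl⟩, fun v _ => ?_⟩
      rfl
  · have hQ' : Nat.card (G ⧸ H) ≤ 2 * N₁ := by omega
    -- Schreier elements: if `v = h * p.out`, then `v * s` has `H`-coordinate `h * z (p, s)`. At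
    -- most `2 * N₁ * K` of them occur.
    let z : (G ⧸ H) × G → H := fun p =>
      ⟨p.1.out * p.2 * (p.1 * (p.2 : G ⧸ H)).out⁻¹, by
        rw [← QuotientGroup.eq_one_iff]; simp⟩
    obtain ⟨F, hFne, hFN, hF⟩ := h₂ (((Finset.univ : Finset (G ⧸ H)) ×ˢ S).image z) (by
      refine Finset.card_image_le.trans ?_
      rw [Finset.card_product, Finset.card_univ, ← Nat.card_eq_fintype_card]
      exact Nat.mul_le_mul hQ' hS)
    refine ⟨{g | (e g).2 ∈ F}, ?_, ?_, hF.of_equiv_prod e ?_⟩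
    · obtain ⟨x, hx⟩ := hFne
      exact ⟨e.symm (1, x), by simpa using hx⟩
    · have hHN : 2 * N₂ ≤ Nat.card H := by
        rw [hcard] at hG
        have := hG.trans (Nat.mul_le_mul_right _ hQ')
        exact Nat.le_of_mul_le_mul_left this (by omega)
      rw [ncard_setOf_snd_mem e (fun _ => F), hcard]
      simp only [Finset.sum_const, Finset.card_univ, smul_eq_mul, ← Nat.card_eq_fintype_card]
      nlinarith [Nat.zero_le (Nat.card (G ⧸ H))]
    · rintro _ ⟨s, hs, rfl⟩ p
      refine ⟨_, ⟨z (p, s), ?_, rfl⟩, fun v hv => ?_⟩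
      · simp only [Finset.coe_image, Finset.coe_product]
        exact ⟨(p, s), ⟨by simp, hs⟩, rfl⟩
      · subst hv
        ext
        simp [he1, he2, z, mul_assoc]

/-- Inversion preserves cardinality and turns right translation by `s⁻¹` into left translation by
`s`. -/
lemma IsAlmostInvariant.inv_left {G : Type*} [Group G] {S : Set G} {ε : ℝ} {A : Set G}
    (hA : IsAlmostInvariant ((fun s g => g * s) '' ((·⁻¹) '' S)) ε A) :
    IsAlmostInvariant ((fun s g => s * g) '' S) ε ((·⁻¹) ⁻¹' A) := by
  rintro _ ⟨s, hs, rfl⟩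
  have hncard : ∀ X : Set G, ((·⁻¹) ⁻¹' X).ncard = X.ncard := fun X =>
    Set.ncard_preimage_of_injective_subset_range inv_injective
      (by rw [inv_surjective.range_eq]; exact Set.subset_univ _)
  have h := hA _ ⟨s⁻¹, ⟨s, hs, rfl⟩, rfl⟩
  rw [← hncard, ← hncard A] at h
  simpa [Set.preimage] using h

/-! ### From almost invariance to edge expansion -/

section expansion

variable {V ι : Type*} [Finite V]

lemma ncard_edgeBoundary_le (f : ι → Equiv.Perm V) (S : Finset ι) (A : Set V) :
    (edgeBoundary (SimpleGraph.fromRel fun u v => ∃ s ∈ S, v = f s u) A).ncard ≤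
      ∑ s ∈ S, 2 * ({u ∈ A | f s u ∉ A} : Set V).ncard := by
  -- A permutation of a finite set moves as many points into `A` as out of it; hence the factor 2.
  have hout : ∀ s, ({u | u ∉ A ∧ f s u ∈ A} : Set V).ncard = ({u ∈ A | f s u ∉ A} : Set V).ncard := by
    intro s
    have h1 : (f s ⁻¹' A).ncard = A.ncard :=
      Set.ncard_preimage_of_injective_subset_range (f s).injective (by simp)
    have h2 := Set.ncard_inter_add_ncard_sdiff_eq_ncard (f s ⁻¹' A) A (Set.toFinite _)
    have h3 := Set.ncard_inter_add_ncard_sdiff_eq_ncard A (f s ⁻¹' A) (Set.toFinite _)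
    have h4 : {u | u ∉ A ∧ f s u ∈ A} = f s ⁻¹' A \ A := by ext; simp [and_comm]
    have h5 : {u ∈ A | f s u ∉ A} = A \ f s ⁻¹' A := rfl
    rw [Set.inter_comm] at h2
    rw [h4, h5]
    omega
  have hsub : edgeBoundary (SimpleGraph.fromRel fun u v => ∃ s ∈ S, v = f s u) A ⊆
      ⋃ s ∈ S, (fun u => s(u, f s u)) '' {u ∈ A | f s u ∉ A} ∪
        (fun u => s(f s u, u)) '' {u | u ∉ A ∧ f s u ∈ A} := by
    rintro _ ⟨he, u, hu, v, hv, rfl⟩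
    rw [SimpleGraph.mem_edgeSet, SimpleGraph.fromRel_adj] at he
    simp only [Set.mem_iUnion]
    rcases he.2 with ⟨s, hs, rfl⟩ | ⟨s, hs, rfl⟩
    · exact ⟨s, hs, Or.inl ⟨u, ⟨hu, hv⟩, rfl⟩⟩
    · exact ⟨s, hs, Or.inr ⟨v, ⟨hv, hu⟩, rfl⟩⟩
  refine (Set.ncard_le_ncard hsub (Set.toFinite _)).trans ?_
  refine (Finset.set_ncard_biUnion_le _ _).trans (Finset.sum_le_sum fun s _ => ?_)
  refine (Set.ncard_union_le _ _).trans ?_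
  have h1 := Set.ncard_image_le (f := fun u => s(u, f s u)) (Set.toFinite {u ∈ A | f s u ∉ A})
  have h2 := Set.ncard_image_le (f := fun u => s(f s u, u)) (Set.toFinite {u | u ∉ A ∧ f s u ∈ A})
  rw [hout] at h2
  omega

lemma cheeger_le_of_almostInvariant (f : ι → Equiv.Perm V) (S : Finset ι) {K : ℕ}
    (hS : S.card ≤ K) {ε : ℝ} (hε : 0 ≤ ε) {A : Set V} (hne : A.Nonempty)
    (hcard : 2 * A.ncard ≤ Nat.card V)
    (hA : IsAlmostInvariant ((fun s v => f s v) '' (S : Set ι)) ε A) :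
    cheeger (SimpleGraph.fromRel fun u v => ∃ s ∈ S, v = f s u) ≤ 2 * K * ε := by
  have hpos : (0 : ℝ) < A.ncard := by exact_mod_cast (Set.ncard_pos (Set.toFinite A)).2 hne
  have hc : 2 * (A.ncard : ℝ) ≤ Nat.card V := by exact_mod_cast hcard
  have hbdd : BddBelow {r : ℝ | ∃ B : Set V, B.Nonempty ∧ (B.ncard : ℝ) ≤ (Nat.card V : ℝ) / 2 ∧
      r = ((edgeBoundary (SimpleGraph.fromRel fun u v => ∃ s ∈ S, v = f s u) B).ncard : ℝ) /
        (B.ncard : ℝ)} := by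
    refine ⟨0, ?_⟩
    rintro _ ⟨B, -, -, rfl⟩
    positivity
  refine (csInf_le hbdd ⟨A, hne, by linarith, rfl⟩).trans ?_
  rw [div_le_iff₀ hpos]
  calc ((edgeBoundary (SimpleGraph.fromRel fun u v => ∃ s ∈ S, v = f s u) A).ncard : ℝ)
      ≤ ∑ s ∈ S, 2 * (({u ∈ A | f s u ∉ A} : Set V).ncard : ℝ) := by
        exact_mod_cast ncard_edgeBoundary_le f S A
    _ ≤ ∑ s ∈ S, 2 * (ε * A.ncard) :=
        Finset.sum_le_sum fun s hs => by
          have := hA _ ⟨s, hs, rfl⟩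
          linarith
    _ = S.card * (2 * (ε * A.ncard)) := by simp
    _ ≤ K * (2 * (ε * A.ncard)) := by gcongr
    _ = 2 * K * ε * A.ncard := by ring

end expansion

/-- The Cayley graphs of large groups with an abelian subgroup containing the commutator subgroup,
with boundedly many generators, have small Cheeger constants. -/
lemma exists_cheeger_cayley_lt (K : ℕ) {c : ℝ} (hc : 0 < c) :
    ∃ N : ℕ, ∀ {G : Type*} [Group G] (H : Subgroup G) [IsMulCommutative H] (S : Finset G),
      commutator G ≤ H → N ≤ Nat.card G → S.card ≤ K →
      cheeger (leftCayley (S : Set G)) < c ∧ cheeger (rightCayley (S : Set G)) < c := by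
  classical
  -- The `+ 1` covers `K = 0` and makes `2 * K * ε < c` strict.
  have hε : 0 < c / (2 * K + 1) := by positivity
  have hlt : 2 * K * (c / (2 * K + 1)) < c := by
    rw [← mul_div_assoc, div_lt_iff₀ (by positivity)]
    linarith
  obtain ⟨N, hN, h⟩ := exists_almostInvariant_mul_right K hε
  refine ⟨N, ?_⟩
  intro G _ H _ S hH hG hS
  have hfin : Finite G := Nat.finite_of_card_ne_zero (by omega)
  constructor
  · obtain ⟨A, hne, hcard, hA⟩ := h H (S.image (·⁻¹)) hH hG (Finset.card_image_le.trans hS) hfin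
    rw [Finset.coe_image] at hA
    refine (cheeger_le_of_almostInvariant (fun s : G => Equiv.mulLeft s) S hS hε.le
      (hne.preimage inv_surjective) ?_ hA.inv_left).trans_lt hlt
    rwa [Set.ncard_preimage_of_injective_subset_range inv_injective
      (by rw [inv_surjective.range_eq]; exact Set.subset_univ _)]
  · obtain ⟨A, hne, hcard, hA⟩ := h H S hH hG hS hfin
    exact (cheeger_le_of_almostInvariant (fun s : G => Equiv.mulRight s) S hS hε.le
      hne hcard hA).trans_lt hlt

lemma not_isExpanding {V : ℕ → Type*} {Γ : ∀ i, SimpleGraph (V i)}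
    (h : ∀ c : ℝ, 0 < c → ∀ᶠ i in atTop, cheeger (Γ i) < c) : ¬ IsExpanding Γ := by
  rintro ⟨c, hc, hΓ⟩
  obtain ⟨i, h1, h2⟩ := (hΓ.and (h c hc)).exists
  exact absurd h1 (not_le.2 h2)

/-! ### Structure of the ZSZ groups -/

section presentation

variable (ℓ m q : ℕ)

/-- The generator `y` of the ZSZ group. -/
def ZSZ.y : ZSZ ℓ m q := PresentedGroup.of 1

lemma ZSZ.x_pow : ZSZ.x ℓ m q ^ ℓ = 1 :=
  PresentedGroup.one_of_mem (rels := zszRels ℓ m q) (x := FreeGroup.of 0 ^ ℓ) (by simp [zszRels])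

lemma ZSZ.y_pow : ZSZ.y ℓ m q ^ m = 1 :=
  PresentedGroup.one_of_mem (rels := zszRels ℓ m q) (x := FreeGroup.of 1 ^ m) (by simp [zszRels])

lemma ZSZ.conj_x : ZSZ.y ℓ m q * ZSZ.x ℓ m q * (ZSZ.y ℓ m q)⁻¹ = ZSZ.x ℓ m q ^ q :=
  mul_inv_eq_one.1 <| PresentedGroup.one_of_mem (rels := zszRels ℓ m q)
    (x := FreeGroup.of 1 * FreeGroup.of 0 * (FreeGroup.of 1)⁻¹ * (FreeGroup.of 0 ^ q)⁻¹)
    (by simp [zszRels])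

lemma ZSZ.zpowers_sup_zpowers :
    Subgroup.zpowers (ZSZ.x ℓ m q) ⊔ Subgroup.zpowers (ZSZ.y ℓ m q) = ⊤ := by
  rw [eq_top_iff, ← PresentedGroup.closure_range_of, Subgroup.closure_le]
  rintro _ ⟨i, rfl⟩
  fin_cases i
  · exact Subgroup.mem_sup_left (Subgroup.mem_zpowers _)
  · exact Subgroup.mem_sup_right (Subgroup.mem_zpowers _)

variable {ℓ m q}

lemma ZSZ.zpowers_x_normal (hℓ : 0 < ℓ) : (Subgroup.zpowers (ZSZ.x ℓ m q)).Normal := by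
  have hfin : Finite (Subgroup.zpowers (ZSZ.x ℓ m q)) :=
    (isOfFinOrder_iff_pow_eq_one.2 ⟨ℓ, hℓ, ZSZ.x_pow ℓ m q⟩).finite_zpowers
  rw [← Subgroup.normalizer_eq_top_iff, eq_top_iff, ← ZSZ.zpowers_sup_zpowers, sup_le_iff]
  refine ⟨Subgroup.le_normalizer, ?_⟩
  rw [Subgroup.zpowers_le]
  -- As `⟨x⟩` is finite, it suffices that conjugation by `y` maps it into itself.
  refine Subgroup.mem_normalizer_fintype ?_
  rintro _ ⟨k, rfl⟩
  refine ⟨q * k, ?_⟩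
  simp only
  rw [← conj_zpow, ZSZ.conj_x, zpow_mul, zpow_natCast]

lemma ZSZ.commutator_le (hℓ : 0 < ℓ) :
    commutator (ZSZ ℓ m q) ≤ Subgroup.zpowers (ZSZ.x ℓ m q) :=
  have := ZSZ.zpowers_x_normal (m := m) (q := q) hℓ
  Subgroup.Normal.commutator_le_of_self_sup_commutative_eq_top
    (ZSZ.zpowers_sup_zpowers ℓ m q) inferInstance

lemma ZSZ.commute_of_modEq (hq : q ≡ 1 [MOD ℓ]) : Commute (ZSZ.y ℓ m q) (ZSZ.x ℓ m q) := by
  have h := ZSZ.conj_x ℓ m q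
  rw [pow_eq_pow_of_modEq hq (ZSZ.x_pow ℓ m q), pow_one] at h
  exact mul_inv_eq_iff_eq_mul.1 h

lemma ZSZ.commutator_eq_bot_of_modEq (hq : q ≡ 1 [MOD ℓ]) : commutator (ZSZ ℓ m q) = ⊥ := by
  have hyx := ZSZ.commute_of_modEq (m := m) hq
  have hcent : ∀ g, Commute g (ZSZ.x ℓ m q) → Commute g (ZSZ.y ℓ m q) →
      Subgroup.zpowers g ≤ Subgroup.center (ZSZ ℓ m q) := by
    intro g hx hy
    have htop : Subgroup.centralizer {g} = ⊤ := by
      rw [eq_top_iff, ← ZSZ.zpowers_sup_zpowers, sup_le_iff, Subgroup.zpowers_le,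
        Subgroup.zpowers_le, Subgroup.mem_centralizer_singleton_iff,
        Subgroup.mem_centralizer_singleton_iff]
      exact ⟨hx.symm.eq, hy.symm.eq⟩
    rw [Subgroup.zpowers_le, Subgroup.mem_center_iff]
    intro h
    rw [← Subgroup.mem_centralizer_singleton_iff, htop]
    trivial
  rw [commutator_eq_bot_iff_center_eq_top, eq_top_iff, ← ZSZ.zpowers_sup_zpowers, sup_le_iff]
  exact ⟨hcent _ (Commute.refl _) hyx.symm, hcent _ hyx (Commute.refl _)⟩

/-- The affine action of the ZSZ group on `ℤ/ℓ`: `x` acts as `a ↦ a + 1`, `y` as `a ↦ q * a`. -/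
lemma ZSZ.exists_affine_action (hq : q ^ m ≡ 1 [MOD ℓ]) (hm : 0 < m) :
    ∃ φ : ZSZ ℓ m q →* Equiv.Perm (ZMod ℓ), ∀ a, φ (ZSZ.x ℓ m q) a = a + 1 := by
  have hqm : (q : ZMod ℓ) ^ m = 1 := by
    have := (ZMod.natCast_eq_natCast_iff _ _ _).2 hq
    simpa using this
  -- Since `q ^ m = 1` with `m > 0`, `q` is a unit, so multiplication by it is a permutation.
  let u : (ZMod ℓ)ˣ := Units.ofPowEqOne (q : ZMod ℓ) m hqm hm.ne'
  have hum : u ^ m = 1 := Units.pow_ofPowEqOne hqm hm.ne'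
  let X : Equiv.Perm (ZMod ℓ) := Equiv.addRight 1
  let Y : Equiv.Perm (ZMod ℓ) := MulAction.toPermHom (ZMod ℓ)ˣ (ZMod ℓ) u
  have hX : ∀ k : ℕ, ∀ a, (X ^ k) a = a + k := by
    intro k
    induction k with
    | zero => simp
    | succ k ih =>
      intro a
      rw [pow_succ', Equiv.Perm.mul_apply, ih]
      simp [X, add_assoc]
  have hY : ∀ a, Y a = q * a := fun a => rfl
  have hrel : ∀ r ∈ zszRels ℓ m q, FreeGroup.lift ![X, Y] r = 1 := by
    rintro r (rfl | rfl | rfl)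
    · ext1 a
      simp [hX]
    · simp only [map_pow, FreeGroup.lift_apply_of]
      show Y ^ m = 1
      rw [← map_pow, hum, map_one]
    · simp only [map_mul, map_inv, map_pow, FreeGroup.lift_apply_of]
      show Y * X * Y⁻¹ * (X ^ q)⁻¹ = 1
      rw [mul_inv_eq_one, mul_inv_eq_iff_eq_mul]
      ext1 a
      simp only [Equiv.Perm.mul_apply, hX, hY]
      simp [X, mul_add]
  refine ⟨PresentedGroup.toGroup hrel, fun a => ?_⟩
  rw [ZSZ.x, PresentedGroup.toGroup.of]
  rfl

/-- If the group is abelian, then `x ^ q = x`; applying both sides to `0` in the affine action gives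
`q = 1` in `ZMod ℓ`. -/
lemma ZSZ.commutator_eq_bot_iff (hm : 0 < m) (hq : q ^ m ≡ 1 [MOD ℓ]) :
    commutator (ZSZ ℓ m q) = ⊥ ↔ q ≡ 1 [MOD ℓ] := by
  refine ⟨fun h => ?_, ZSZ.commutator_eq_bot_of_modEq⟩
  obtain ⟨φ, hφ⟩ := ZSZ.exists_affine_action hq hm
  have hc : ZSZ.x ℓ m q ^ q = ZSZ.x ℓ m q := by
    have h1 := Subgroup.commutator_mem_commutator (Subgroup.mem_top (ZSZ.y ℓ m q))
      (Subgroup.mem_top (ZSZ.x ℓ m q))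
    rw [← commutator_def, h, Subgroup.mem_bot, commutatorElement_def, ZSZ.conj_x] at h1
    exact mul_inv_eq_one.1 h1
  have hk : ∀ k : ℕ, φ (ZSZ.x ℓ m q ^ k) 0 = k := by
    intro k
    induction k with
    | zero => simp
    | succ k ih => rw [pow_succ', map_mul, Equiv.Perm.mul_apply, ih, hφ]; simp
  have h2 := hk q
  rw [hc, hφ] at h2
  rw [← ZMod.natCast_eq_natCast_iff]
  simpa using h2.symm

end presentation

/-! ### Derived length -/

section derivedLength

variable {G : Type*} [Group G]

lemma derivedLength_le_of_derivedSeries_eq_bot {k : ℕ} (h : derivedSeries G k = ⊥) :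
    derivedLength G ≤ k :=
  sInf_le ⟨k, h, rfl⟩

lemma le_derivedLength_of_derivedSeries_ne_bot {k : ℕ} (h : derivedSeries G k ≠ ⊥) :
    ((k + 1 : ℕ) : ℕ∞) ≤ derivedLength G := by
  refine le_sInf ?_
  rintro _ ⟨n, hn, rfl⟩
  refine Nat.cast_le.2 (Nat.succ_le_of_lt (not_le.1 fun hnk => h ?_))
  exact le_bot_iff.1 ((derivedSeries_antitone G hnk).trans_eq hn)

lemma derivedSeries_two_eq_bot {H : Subgroup G} [IsMulCommutative H] (h : commutator G ≤ H) :
    derivedSeries G 2 = ⊥ := by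
  rw [derivedSeries_succ, derivedSeries_one, ← le_bot_iff]
  refine (Subgroup.commutator_mono h h).trans ?_
  rw [le_bot_iff, Subgroup.commutator_eq_bot_iff_le_centralizer]
  exact Subgroup.le_centralizer H

lemma derivedLength_eq_two_iff (h : derivedSeries G 2 = ⊥) :
    derivedLength G = 2 ↔ commutator G ≠ ⊥ := by
  constructor
  · intro h2 hc
    have := derivedLength_le_of_derivedSeries_eq_bot (k := 1) ((derivedSeries_one G).trans hc)
    rw [h2] at this
    exact absurd this (by decide)
  · intro hc
    rw [← derivedSeries_one] at hc
    exact le_antisymm (derivedLength_le_of_derivedSeries_eq_bot h)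
      (le_derivedLength_of_derivedSeries_ne_bot hc)

end derivedLength

theorem mainTheorem5 :
    (∀ ℓ m q : ℕ, 0 < ℓ → 0 < m → 0 < q → q ^ m ≡ 1 [MOD ℓ] →
      commutator (ZSZ ℓ m q) ≤ Subgroup.zpowers (ZSZ.x ℓ m q) ∧
      derivedLength (ZSZ ℓ m q) ≤ 2 ∧
      (derivedLength (ZSZ ℓ m q) = 2 ↔ ¬ q ≡ 1 [MOD ℓ])) ∧
    (∀ (ℓ m q : ℕ → ℕ), (∀ i, 0 < ℓ i) → (∀ i, 0 < m i) → (∀ i, 0 < q i) →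
      (∀ i, q i ^ m i ≡ 1 [MOD ℓ i]) →
      Tendsto (fun i => Nat.card (ZSZ (ℓ i) (m i) (q i))) atTop atTop →
      ∀ (K : ℕ) (S : ∀ i, Finset (ZSZ (ℓ i) (m i) (q i))), (∀ i, (S i).card ≤ K) →
        ¬ IsExpanding (fun i => leftCayley (S i : Set (ZSZ (ℓ i) (m i) (q i)))) ∧
        ¬ IsExpanding (fun i => rightCayley (S i : Set (ZSZ (ℓ i) (m i) (q i))))) := by
  refine ⟨fun ℓ m q hℓ hm _ h => ?_, fun ℓ m q hℓ _ _ _ hG K S hS => ?_⟩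
  · have hcomm := ZSZ.commutator_le (m := m) (q := q) hℓ
    have h2 := derivedSeries_two_eq_bot hcomm
    exact ⟨hcomm, derivedLength_le_of_derivedSeries_eq_bot h2,
      (derivedLength_eq_two_iff h2).trans (ZSZ.commutator_eq_bot_iff hm h).not⟩
  · have key : ∀ c : ℝ, 0 < c → ∀ᶠ i in atTop,
        cheeger (leftCayley (S i : Set (ZSZ (ℓ i) (m i) (q i)))) < c ∧
        cheeger (rightCayley (S i : Set (ZSZ (ℓ i) (m i) (q i)))) < c := by
      intro c hc
      obtain ⟨N, hN⟩ := exists_cheeger_cayley_lt K hc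
      filter_upwards [hG.eventually_ge_atTop N] with i hi
      exact hN _ (S i) (ZSZ.commutator_le (hℓ i)) hi (hS i)
    exact ⟨not_isExpanding fun c hc => (key c hc).mono fun _ h => h.1,
      not_isExpanding fun c hc => (key c hc).mono fun _ h => h.2⟩
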